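/- Consider the $(a:b)$ Maker-Breaker minimum-degree-$k$ game on $K_n$: Maker and Breaker alternately claim previously unclaimed edges of the complete graph $K_n$, Maker claiming $a$ and Breaker $b$ edges per move (all remaining edges, if fewer are left), until all edges are claimed; Maker wins if his edges then form a spanning subgraph of minimum degree at least $k$, and otherwise Breaker wins. Theorem. Let $a=a(n)$ and $k=k(n)$ be sequences of positive integers with $a=o(\sqrt n)$ and $k=o(n)$. For every $\varepsilon>0$ there is an $n_0\in\mathbb N$ (depending on $\varepsilon$ and on the sequences $a$ and $k$) such that for every $n\ge n_0$ and every integer $b\ge(1+\varepsilon)\frac{an}{a+\ln n}$, Breaker has a winning strategy in the $(a:b)$ minimum-degree-$k$ game on $K_n$, no matter which of the two players moves first. -/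

import Mathlib

namespace MakerBreaker

/-- The two players of a Maker-Breaker game. -/
inductive Player where
  | maker : Player
  | breaker : Player

/-- The opponent of a player. -/
def Player.other : Player → Player
  | .maker => .breaker
  | .breaker => .maker

/-- The player who makes move number `t` (counted from `0`) when `first` starts and the players
alternate. -/
def turn (first : Player) (t : ℕ) : Player :=
  if Even t then first else first.other

/-- The bias of each player in the `(a : b)` game. -/
def bias (a b : ℕ) : Player → ℕ
  | .maker => a
  | .breaker => b

/-- A position: the elements claimed so far by Maker and those claimed so far by Breaker. -/
@[ext]
structure Position (α : Type*) where
  maker : Finset α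
  breaker : Finset α

section

variable {α : Type*} [DecidableEq α]

/-- The unclaimed elements of the board `X`. -/
def Position.free (X : Finset α) (P : Position α) : Finset α :=
  X \ (P.maker ∪ P.breaker)

/-- The position after a player has claimed the elements of `S`. -/
def Position.claim (P : Position α) (S : Finset α) : Player → Position α
  | .maker => ⟨P.maker ∪ S, P.breaker⟩
  | .breaker => ⟨P.maker, P.breaker ∪ S⟩

/-- `S` is a legal move with bias `q`: exactly `q` unclaimed elements of the board, or all the
unclaimed elements if there are fewer than `q` of them. -/
def IsMove (X : Finset α) (q : ℕ) (P : Position α) (S : Finset α) : Prop :=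
  S ⊆ P.free X ∧ S.card = min q (P.free X).card

/-- `p` is the sequence of positions of a play of the `(a : b)` game on the board `X`, started by
`first`; once the board is exhausted, the position no longer changes. -/
def IsPlay (X : Finset α) (a b : ℕ) (first : Player) (p : ℕ → Position α) : Prop :=
  p 0 = ⟨∅, ∅⟩ ∧
    ∀ t, ∃ S, IsMove X (bias a b (turn first t)) (p t) S ∧
      p (t + 1) = (p t).claim S (turn first t)

/-- Breaker wins the `(a : b)` Maker-Breaker game with board `X` and family of winning sets `F`,
started by `first`: he has a strategy `σ` (a legal move in every position) such that in every play
in which he follows `σ`, Maker does not occupy a winning set. Since Maker's set only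
grows, it is the same to require this at all times or at the end of the play. -/
def BreakerWins (X : Finset α) (F : Set (Finset α)) (a b : ℕ) (first : Player) : Prop :=
  ∃ σ : Position α → Finset α, (∀ P, IsMove X b P (σ P)) ∧
    ∀ p : ℕ → Position α, IsPlay X a b first p →
      (∀ t, turn first t = .breaker → p (t + 1) = (p t).claim (σ (p t)) .breaker) →
        ∀ t, ∀ W ∈ F, ¬ W ⊆ (p t).maker

end

/-- The board: the edge set of the complete graph on `n` vertices. -/
def completeBoard (n : ℕ) : Finset (Sym2 (Fin n)) :=
  (⊤ : SimpleGraph (Fin n)).edgeFinset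

/-- The winning sets of the minimum-degree-`k` game: the edge sets of the spanning subgraphs of
`K_n` with minimum degree at least `k`. -/
def minDegreeSets (n k : ℕ) : Set (Finset (Sym2 (Fin n))) :=
  {W | W ⊆ completeBoard n ∧
    k ≤ (SimpleGraph.fromEdgeSet (W : Set (Sym2 (Fin n)))).minDegree}

/-- Breaker wins the `(a : b)` minimum-degree-`k` game on `K_n` in which `first` starts. -/
def BreakerWinsMinDegree (n k a b : ℕ) (first : Player) : Prop :=
  BreakerWins (completeBoard n) (minDegreeSets n k) a b first

end MakerBreaker

namespace MakerBreaker

/-! ### Positional strategies and forcing. -/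

section

variable {α : Type*} [DecidableEq α]

/-! Since `k ≥ 1`, Breaker wins by isolating one vertex. He first builds a clique of his own on
vertices untouched by Maker: each round he joins `a + 1` new ones to it, and Maker, for whom edges
inside the clique are gone, spoils at most one clique vertex per edge (`IsSafe.claim_maker`), so it
grows by at least 1.

From `1 + J * a` clique vertices he plays a box game (`IsSafe.forces_of_le_sum`), claiming equally
many edges at every surviving vertex while Maker spoils at most `a` per round. The last survivor is
isolated once `∑ i ≤ J, ⌊b / (1 + i * a)⌋ ≥ n`.

This sum is at least `(b / a) * (a + ln (J + 1) - 1) - J`. With `J` about `n / (ln n)^4`, `ln J` is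
`(1 - o(1)) ln n`, which matches the threshold for `b`, while the clique is small enough to be
built. -/

theorem IsMove.exists_superset {X : Finset α} {q : ℕ} {P : Position α} {T : Finset α}
    (hT : T ⊆ P.free X) (hq : T.card ≤ q) : ∃ S, IsMove X q P S ∧ T ⊆ S := by
  obtain ⟨S, h1, h2, h3⟩ := Finset.exists_subsuperset_card_eq (n := min q (P.free X).card) hT
    (le_min hq (Finset.card_le_card hT)) (min_le_right _ _)
  exact ⟨S, ⟨h2, h3⟩, h1⟩

theorem IsMove.exists (X : Finset α) (q : ℕ) (P : Position α) : ∃ S, IsMove X q P S :=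
  (IsMove.exists_superset (Finset.empty_subset _) (Nat.zero_le q)).imp fun _ h => h.1

/-- With Breaker to move in `P`, he can reach a position in `G` within `j` rounds. -/
def Forces (X : Finset α) (a b : ℕ) (G : Position α → Prop) : ℕ → Position α → Prop
  | 0, P => G P
  | j + 1, P => G P ∨ ∃ S, IsMove X b P S ∧ ∀ S', IsMove X a (P.claim S .breaker) S' →
      Forces X a b G j ((P.claim S .breaker).claim S' .maker)

variable {X : Finset α} {a b : ℕ} {G : Position α → Prop}

/-- A single positional strategy forces `G` from all the positions from which it can be forced. -/
theorem exists_positional_strategy (X : Finset α) (a b : ℕ) (G : Position α → Prop) :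
    ∃ σ : Position α → Finset α, (∀ P, IsMove X b P (σ P)) ∧
      ∀ P j, Forces X a b G j P → G P ∨ ∃ i < j, ∀ S', IsMove X a (P.claim (σ P) .breaker) S' →
        Forces X a b G i ((P.claim (σ P) .breaker).claim S' .maker) := by
  classical
  have key : ∀ P, ∃ S, IsMove X b P S ∧ ∀ j, Forces X a b G j P → G P ∨ ∃ i < j,
      ∀ S', IsMove X a (P.claim S .breaker) S' →
        Forces X a b G i ((P.claim S .breaker).claim S' .maker) := by
    intro P
    by_cases h : ∃ j, Forces X a b G j P
    · have hmin := Nat.find_spec h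
      have hle : ∀ j, Forces X a b G j P → Nat.find h ≤ j := fun j hj => Nat.find_min' h hj
      generalize Nat.find h = r at hmin hle
      obtain ⟨S₀, hS₀⟩ := IsMove.exists X b P
      cases r with
      | zero => exact ⟨S₀, hS₀, fun j _ => Or.inl hmin⟩
      | succ r =>
        rcases hmin with hG | ⟨S, hS, hS'⟩
        · exact ⟨S₀, hS₀, fun j _ => Or.inl hG⟩
        · exact ⟨S, hS, fun j hj => Or.inr ⟨r, hle j hj, hS'⟩⟩
    · obtain ⟨S₀, hS₀⟩ := IsMove.exists X b P
      exact ⟨S₀, hS₀, fun j hj => absurd ⟨j, hj⟩ h⟩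
  choose σ h1 h2 using key
  exact ⟨σ, h1, h2⟩

theorem turn_succ_succ (first : Player) (t : ℕ) : turn first (t + 1 + 1) = turn first t := by
  simp [turn, Nat.even_add_one]

theorem turn_succ (first : Player) (t : ℕ) : turn first (t + 1) = (turn first t).other := by
  by_cases h : Even t <;> cases first <;> simp [turn, Nat.even_add_one, h, Player.other]

theorem breakerWins_of_forces {F : Set (Finset α)} {first : Player}
    (hpers : ∀ P q S pl, G P → IsMove X q P S → G (P.claim S pl))
    (hF : ∀ P, G P → ∀ W ∈ F, ¬ W ⊆ P.maker)
    (hbreaker : ∃ j, Forces X a b G j ⟨∅, ∅⟩)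
    (hmaker : ∀ S, IsMove X a ⟨∅, ∅⟩ S →
      ∃ j, Forces X a b G j ((⟨∅, ∅⟩ : Position α).claim S .maker)) :
    BreakerWins X F a b first := by
  obtain ⟨σ, hσ, hforce⟩ := exists_positional_strategy X a b G
  refine ⟨σ, hσ, fun p hp hfol t W hW hsub => ?_⟩
  obtain ⟨hp0, hstep⟩ := hp
  have hmono : Monotone fun t => (p t).maker := by
    refine monotone_nat_of_le_succ fun t => ?_
    obtain ⟨S, _, h⟩ := hstep t
    rw [h]
    cases turn first t <;> simp [Position.claim]
  have hG : ∀ s, G (p s) → ∀ d, G (p (s + d)) := by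
    intro s hs d
    induction d with
    | zero => exact hs
    | succ d ih =>
      obtain ⟨S, hS, h⟩ := hstep (s + d)
      rw [← add_assoc, h]
      exact hpers _ _ _ _ ih hS
  have hreach : ∀ j s, turn first s = .breaker → Forces X a b G j (p s) → ∃ s, G (p s) := by
    intro j
    induction j using Nat.strong_induction_on with
    | _ j ih =>
      intro s hs hj
      rcases hforce _ _ hj with h | ⟨i, hi, h⟩
      · exact ⟨s, h⟩
      · have h1 := hfol s hs
        obtain ⟨S, hS, h2⟩ := hstep (s + 1)
        have hs1 : turn first (s + 1) = .maker := by rw [turn_succ, hs]; rfl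
        rw [hs1, h1] at hS h2
        refine ih i hi (s + 1 + 1) ((turn_succ_succ _ _).trans hs) ?_
        rw [h2]
        exact h S hS
  obtain ⟨s, hs⟩ : ∃ s, G (p s) := by
    cases first with
    | breaker =>
      obtain ⟨j, hj⟩ := hbreaker
      exact hreach j 0 (by simp [turn]) (by rwa [hp0])
    | maker =>
      obtain ⟨S, hS, h⟩ := hstep 0
      have h0 : turn .maker 0 = .maker := by simp [turn]
      rw [h0, hp0] at hS h
      obtain ⟨j, hj⟩ := hmaker S hS
      exact hreach j 1 (by simp [turn, Player.other]) (by rwa [h])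
  exact hF _ (hG s hs t) W hW (hsub.trans (hmono (Nat.le_add_left t s)))

end

/-! ### Isolated vertices and safe sets. -/

section

variable {n : ℕ}

/-- Breaker has claimed all the edges at some vertex. -/
def HasIsolated (P : Position (Sym2 (Fin n))) : Prop :=
  ∃ v : Fin n, ∀ e ∈ completeBoard n, v ∈ e → e ∈ P.breaker ∧ e ∉ P.maker

theorem HasIsolated.claim {P : Position (Sym2 (Fin n))} (h : HasIsolated P) {q : ℕ}
    {S : Finset (Sym2 (Fin n))} (hS : IsMove (completeBoard n) q P S) (pl : Player) :
    HasIsolated (P.claim S pl) := by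
  obtain ⟨v, hv⟩ := h
  refine ⟨v, fun e he hve => ?_⟩
  obtain ⟨h1, h2⟩ := hv e he hve
  have h3 : e ∉ S := fun h => by
    have := hS.1 h
    simp [Position.free, h1] at this
  cases pl <;> simp [Position.claim, h1, h2, h3]

theorem HasIsolated.not_subset {P : Position (Sym2 (Fin n))} (h : HasIsolated P) {k : ℕ}
    (hk : 1 ≤ k) {W : Finset (Sym2 (Fin n))} (hW : W ∈ minDegreeSets n k) : ¬ W ⊆ P.maker := by
  classical
  intro hsub
  obtain ⟨v, hv⟩ := h
  obtain ⟨hWX, hdeg⟩ := hW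
  have hpos := (hk.trans hdeg).trans (SimpleGraph.minDegree_le_degree _ v)
  obtain ⟨w, hw⟩ := (SimpleGraph.degree_pos_iff_exists_adj _ v).1 hpos
  have hmem : s(v, w) ∈ W := by simpa using ((SimpleGraph.fromEdgeSet_adj _).1 hw).1
  exact (hv _ (hWX hmem) (Sym2.mem_mk_left v w)).2 (hsub hmem)

/-- Maker has touched no vertex of `U`, and Breaker owns all the edges inside `U`. -/
structure IsSafe (P : Position (Sym2 (Fin n))) (U : Finset (Fin n)) : Prop where
  untouched : ∀ u ∈ U, ∀ e ∈ P.maker, u ∉ e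
  clique : ∀ u ∈ U, ∀ v ∈ U, u ≠ v → s(u, v) ∈ P.breaker

theorem IsSafe.subset {P : Position (Sym2 (Fin n))} {U V : Finset (Fin n)} (h : IsSafe P U)
    (hV : V ⊆ U) : IsSafe P V :=
  ⟨fun u hu => h.untouched u (hV hu), fun u hu v hv => h.clique u (hV hu) v (hV hv)⟩

theorem IsSafe.claim_breaker {P : Position (Sym2 (Fin n))} {U : Finset (Fin n)} (h : IsSafe P U)
    (S : Finset (Sym2 (Fin n))) : IsSafe (P.claim S .breaker) U :=
  ⟨h.untouched, fun u hu v hv huv => Finset.mem_union_left _ (h.clique u hu v hv huv)⟩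

/-- An edge with both ends in `U` already belongs to Breaker, so each edge claimed by Maker spoils
at most one vertex of `U`. -/
theorem IsSafe.claim_maker {P : Position (Sym2 (Fin n))} {U : Finset (Fin n)} (h : IsSafe P U)
    {q : ℕ} {S : Finset (Sym2 (Fin n))} (hS : IsMove (completeBoard n) q P S) :
    ∃ V ⊆ U, IsSafe (P.claim S .maker) V ∧ U.card ≤ V.card + q := by
  classical
  refine ⟨U.filter fun u => ¬ ∃ e ∈ S, u ∈ e, Finset.filter_subset _ _, ⟨?_, ?_⟩, ?_⟩
  · intro u hu e he hue
    rw [Finset.mem_filter] at hu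
    rcases Finset.mem_union.1 he with he | he
    · exact h.untouched u hu.1 e he hue
    · exact hu.2 ⟨e, he, hue⟩
  · intro u hu v hv huv
    exact h.clique u (Finset.mem_filter.1 hu).1 v (Finset.mem_filter.1 hv).1 huv
  · have hcard : (U.filter fun u => ∃ e ∈ S, u ∈ e).card ≤ S.card := by
      have hex : ∀ u, ∃ e, u ∈ U.filter (fun u => ∃ e ∈ S, u ∈ e) → e ∈ S ∧ u ∈ e := by
        intro u
        by_cases hu : u ∈ U.filter fun u => ∃ e ∈ S, u ∈ e
        · obtain ⟨e, he⟩ := (Finset.mem_filter.1 hu).2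
          exact ⟨e, fun _ => he⟩
        -- Dummy value off the filtered set.
        · exact ⟨s(u, u), fun h => absurd h hu⟩
      choose f hf using hex
      refine Finset.card_le_card_of_injOn f (fun u hu => (hf u hu).1) ?_
      intro u hu v hv huv
      by_contra hne
      have h1 : f u = s(u, v) :=
        (Sym2.mem_and_mem_iff hne).1 ⟨(hf u hu).2, by rw [huv]; exact (hf v hv).2⟩
      have h2 := h.clique u (Finset.mem_filter.1 hu).1 v (Finset.mem_filter.1 hv).1 hne
      have h3 := hS.1 (hf u hu).1
      rw [h1] at h3
      simp [Position.free, h2] at h3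
    have hq : S.card ≤ q := hS.2.le.trans (min_le_left _ _)
    have := Finset.card_filter_add_card_filter_not (s := U) (fun u => ∃ e ∈ S, u ∈ e)
    omega

/-! ### Isolating a vertex: the box game. -/

/-- The unclaimed edges at the vertex `u`. -/
def freeAt (P : Position (Sym2 (Fin n))) (u : Fin n) : Finset (Sym2 (Fin n)) :=
  (P.free (completeBoard n)).filter (u ∈ ·)

theorem card_freeAt_le (P : Position (Sym2 (Fin n))) (u : Fin n) : (freeAt P u).card ≤ n := by
  have hsub : freeAt P u ⊆ Finset.univ.image fun w => s(u, w) := by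
    intro e he
    obtain ⟨w, rfl⟩ := Sym2.mem_iff_exists.1 (Finset.mem_filter.1 he).2
    exact Finset.mem_image_of_mem _ (Finset.mem_univ _)
  calc (freeAt P u).card ≤ _ := Finset.card_le_card hsub
    _ ≤ _ := Finset.card_image_le
    _ = n := by simp

theorem free_claim_subset {α : Type*} [DecidableEq α] (X : Finset α) (P : Position α)
    (S : Finset α) (pl : Player) : (P.claim S pl).free X ⊆ P.free X \ S := by
  intro e
  cases pl <;> simp only [Position.free, Position.claim, Finset.mem_sdiff, Finset.mem_union] <;>
    tauto

theorem freeAt_claim_subset (P : Position (Sym2 (Fin n))) (S : Finset (Sym2 (Fin n)))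
    (pl : Player) (u : Fin n) : freeAt (P.claim S pl) u ⊆ freeAt P u \ S := by
  intro e he
  obtain ⟨h1, h2⟩ := Finset.mem_filter.1 he
  have h3 := Finset.mem_sdiff.1 (free_claim_subset _ _ _ _ h1)
  exact Finset.mem_sdiff.2 ⟨Finset.mem_filter.2 ⟨h3.1, h2⟩, h3.2⟩

theorem IsSafe.hasIsolated {P : Position (Sym2 (Fin n))} {U : Finset (Fin n)} (h : IsSafe P U)
    {u : Fin n} (hu : u ∈ U) (hfree : freeAt P u = ∅) : HasIsolated P := by
  refine ⟨u, fun e he hue => ?_⟩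
  have h1 : e ∉ P.maker := fun h1 => h.untouched u hu e h1 hue
  refine ⟨?_, h1⟩
  by_contra h2
  have : e ∈ freeAt P u := by simp [freeAt, Position.free, he, h1, h2, hue]
  simp [hfree] at this

/-- One round of balanced play: Breaker claims `b / |U|` edges at every vertex of `U`. -/
theorem exists_balanced_move (P : Position (Sym2 (Fin n))) (U : Finset (Fin n)) (b s : ℕ)
    (hs : ∀ u ∈ U, (freeAt P u).card ≤ s) :
    ∃ S, IsMove (completeBoard n) b P S ∧
      ∀ u ∈ U, (freeAt (P.claim S .breaker) u).card ≤ s - b / U.card := by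
  have hex : ∀ u, ∃ T ⊆ freeAt P u, T.card = min (b / U.card) (freeAt P u).card :=
    fun u => Finset.exists_subset_card_eq (min_le_right _ _)
  choose T hT hcard using hex
  obtain ⟨S, hS, hTS⟩ := IsMove.exists_superset (X := completeBoard n) (q := b) (P := P)
    (T := U.biUnion T)
    (Finset.biUnion_subset.2 fun u _ => (hT u).trans (Finset.filter_subset _ _))
    ((Finset.card_biUnion_le_card_mul _ _ (b / U.card) fun u _ => by
      rw [hcard]; exact min_le_left _ _).trans (Nat.mul_div_le _ _))
  refine ⟨S, hS, fun u hu => ?_⟩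
  have h1 : freeAt (P.claim S .breaker) u ⊆ freeAt P u \ T u :=
    (freeAt_claim_subset _ _ _ _).trans
      (Finset.sdiff_subset_sdiff le_rfl ((Finset.subset_biUnion_of_mem T hu).trans hTS))
  have h2 := Finset.card_le_card h1
  rw [Finset.card_sdiff_of_subset (hT u), hcard] at h2
  have := hs u hu
  omega

/-- The box game: balanced play isolates a vertex of a large safe set. -/
theorem IsSafe.forces_of_le_sum {a b : ℕ} (J : ℕ) : ∀ {P : Position (Sym2 (Fin n))}
    {U : Finset (Fin n)} {s : ℕ}, IsSafe P U → 1 + J * a ≤ U.card →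
    (∀ u ∈ U, (freeAt P u).card ≤ s) → s ≤ ∑ i ∈ Finset.range (J + 1), b / (1 + i * a) →
    Forces (completeBoard n) a b HasIsolated (J + 1) P := by
  induction J with
  | zero =>
    intro P U s hsafe hU hs hsum
    obtain ⟨V, hVU, hV⟩ := Finset.exists_subset_card_eq hU
    obtain ⟨S, hS, hfree⟩ := exists_balanced_move P V b s fun u hu => hs u (hVU hu)
    obtain ⟨u, hu⟩ : V.Nonempty := Finset.card_pos.1 (by omega)
    refine Or.inr ⟨S, hS, fun S' hS' => ?_⟩
    refine HasIsolated.claim ?_ hS' _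
    refine ((hsafe.subset hVU).claim_breaker S).hasIsolated hu (Finset.card_eq_zero.1 ?_)
    have h1 := hfree u hu
    simp only [zero_mul, add_zero, zero_add, Finset.range_one, Finset.sum_singleton,
      Nat.div_one] at hV hsum
    rw [hV, Nat.div_one] at h1
    omega
  | succ J ih =>
    intro P U s hsafe hU hs hsum
    -- Trimming to exactly `1 + (J + 1) * a` vertices makes `b / V.card` the top term of the sum.
    obtain ⟨V, hVU, hV⟩ := Finset.exists_subset_card_eq hU
    obtain ⟨S, hS, hfree⟩ := exists_balanced_move P V b s fun u hu => hs u (hVU hu)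
    refine Or.inr ⟨S, hS, fun S' hS' => ?_⟩
    obtain ⟨V', hV', hsafe', hcard⟩ := ((hsafe.subset hVU).claim_breaker S).claim_maker hS'
    refine ih (s := s - b / V.card) hsafe' ?_ (fun u hu => ?_) ?_
    · rw [hV, add_mul] at hcard
      omega
    · exact (Finset.card_le_card ((freeAt_claim_subset _ _ _ _).trans
        Finset.sdiff_subset)).trans (hfree u (hV' hu))
    · rw [Finset.sum_range_succ, ← hV] at hsum
      omega

/-! ### Building the safe set. -/

theorem card_filter_exists_mem_le (M : Finset (Sym2 (Fin n))) :
    (Finset.univ.filter fun v => ∃ e ∈ M, v ∈ e).card ≤ M.card * 2 := by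
  have hsub : (Finset.univ.filter fun v => ∃ e ∈ M, v ∈ e) ⊆ M.biUnion Sym2.toFinset := by
    intro v hv
    obtain ⟨e, he, hve⟩ := (Finset.mem_filter.1 hv).2
    exact Finset.mem_biUnion.2 ⟨e, he, Sym2.mem_toFinset.2 hve⟩
  refine (Finset.card_le_card hsub).trans (Finset.card_biUnion_le_card_mul _ _ _ fun e _ => ?_)
  by_cases h : e.IsDiag
  · rw [Sym2.card_toFinset_of_isDiag e h]; norm_num
  · rw [Sym2.card_toFinset_of_not_isDiag e h]

/-- Breaker enlarges a safe set by `c` vertices untouched by Maker. -/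
theorem IsSafe.exists_extending_move {P : Position (Sym2 (Fin n))} {U : Finset (Fin n)}
    (h : IsSafe P U) {b c : ℕ} (hroom : 2 * P.maker.card + U.card + c ≤ n)
    (hb : c * (U.card + c) ≤ b) :
    ∃ S, IsMove (completeBoard n) b P S ∧
      ∃ V, IsSafe (P.claim S .breaker) V ∧ V.card = U.card + c := by
  classical
  set D := Finset.univ.filter fun v => ∃ e ∈ P.maker, v ∈ e with hD
  have hc : c ≤ (Dᶜ \ U).card := by
    have h1 : D.card ≤ P.maker.card * 2 := card_filter_exists_mem_le P.maker
    have h2 := Finset.card_compl D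
    have h3 := Finset.le_card_sdiff U Dᶜ
    rw [Fintype.card_fin] at h2
    omega
  obtain ⟨A, hAN, hA⟩ := Finset.exists_subset_card_eq hc
  have hdisj : Disjoint U A := by
    refine Finset.disjoint_left.2 fun v hv hvA => ?_
    exact (Finset.mem_sdiff.1 (hAN hvA)).2 hv
  have hcard : (U ∪ A).card = U.card + c := by rw [Finset.card_union_of_disjoint hdisj, hA]
  have huntouched : ∀ v ∈ U ∪ A, ∀ e ∈ P.maker, v ∉ e := by
    intro v hv e he hve
    rcases Finset.mem_union.1 hv with hv | hv
    · exact h.untouched v hv e he hve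
    · exact Finset.mem_compl.1 (Finset.mem_sdiff.1 (hAN hv)).1
        (Finset.mem_filter.2 ⟨Finset.mem_univ v, e, he, hve⟩)
  -- At most `c * (U.card + c)` edges; the intersection discards loops and edges Breaker already
  -- owns.
  set T := ((A ×ˢ (U ∪ A)).image fun x => s(x.1, x.2)) ∩ P.free (completeBoard n) with hT
  obtain ⟨S, hS, hTS⟩ := IsMove.exists_superset (q := b) (T := T) Finset.inter_subset_right (by
    refine ((Finset.card_le_card Finset.inter_subset_left).trans Finset.card_image_le).trans ?_
    rwa [Finset.card_product, hA, hcard])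
  have hnew : ∀ u ∈ A, ∀ v ∈ U ∪ A, u ≠ v → s(u, v) ∈ (P.claim S .breaker).breaker := by
    intro u hu v hv huv
    by_cases hmem : s(u, v) ∈ P.breaker
    · exact Finset.mem_union_left _ hmem
    · refine Finset.mem_union_right _ (hTS (Finset.mem_inter.2
        ⟨Finset.mem_image.2 ⟨(u, v), Finset.mem_product.2 ⟨hu, hv⟩, rfl⟩, ?_⟩))
      have hm : s(u, v) ∉ P.maker := fun hm =>
        huntouched v hv _ hm (Sym2.mem_mk_right u v)
      simp [Position.free, completeBoard, huv, hmem, hm]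
  refine ⟨S, hS, U ∪ A, ⟨huntouched, fun u hu v hv huv => ?_⟩, hcard⟩
  rcases Finset.mem_union.1 hu with hu' | hu'
  · rcases Finset.mem_union.1 hv with hv' | hv'
    · exact Finset.mem_union_left _ (h.clique u hu' v hv' huv)
    · rw [Sym2.eq_swap]
      exact hnew v hv' u hu huv.symm
  · exact hnew u hu' v hv huv

/-- Here `r` counts the vertices still missing, one gained per round; the term `r * a` reserves room
for Maker's edges in those rounds. -/
theorem IsSafe.forces {a b J : ℕ} (hb : (a + 1) * (1 + J * a + (a + 1)) ≤ b)
    (hsum : n ≤ ∑ i ∈ Finset.range (J + 1), b / (1 + i * a)) (r : ℕ) :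
    ∀ {P : Position (Sym2 (Fin n))} {U : Finset (Fin n)}, IsSafe P U →
    U.card + r = 1 + J * a →
    2 * (P.maker.card + r * a) + (1 + J * a) + (a + 1) ≤ n →
    Forces (completeBoard n) a b HasIsolated (r + (J + 1)) P := by
  induction r with
  | zero =>
    intro P U hsafe hU _
    rw [zero_add]
    exact hsafe.forces_of_le_sum J hU.ge (fun u _ => card_freeAt_le P u) hsum
  | succ r ih =>
    intro P U hsafe hU hroom
    have hUle : U.card ≤ 1 + J * a := by omega
    have hra : (r + 1) * a = r * a + a := Nat.succ_mul r a
    obtain ⟨S, hS, V, hV, hVcard⟩ := hsafe.exists_extending_move (b := b) (c := a + 1)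
      (by omega) (le_trans (by gcongr) hb)
    rw [Nat.add_right_comm]
    refine Or.inr ⟨S, hS, fun S' hS' => ?_⟩
    obtain ⟨V', hV', hsafe', hcard⟩ := hV.claim_maker hS'
    obtain ⟨V'', hV'', hcard''⟩ := Finset.exists_subset_card_eq (s := V') (n := U.card + 1)
      (by omega)
    refine ih (hsafe'.subset hV'') (by omega) ?_
    have h1 : ((P.claim S .breaker).claim S' .maker).maker.card ≤ P.maker.card + S'.card :=
      Finset.card_union_le _ _
    have h2 : S'.card ≤ a := hS'.2.le.trans (min_le_left _ _)
    omega

/-- A numerical criterion for Breaker's win in the minimum-degree game. -/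
theorem breakerWinsMinDegree_of_le_sum {k a b : ℕ} (hk : 1 ≤ k) (J : ℕ)
    (hroom : 2 * ((2 + J * a) * a) + (1 + J * a) + (a + 1) ≤ n)
    (hb : (a + 1) * (1 + J * a + (a + 1)) ≤ b)
    (hsum : n ≤ ∑ i ∈ Finset.range (J + 1), b / (1 + i * a)) (first : Player) :
    BreakerWinsMinDegree n k a b first := by
  -- The extra `a` pays for Maker's opening move when he starts.
  have hr : (2 + J * a) * a = (1 + J * a) * a + a := by ring
  refine breakerWins_of_forces (G := HasIsolated) (fun P q S pl h hS => h.claim hS pl)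
    (fun P h W hW => h.not_subset hk hW) 
    ⟨1 + J * a + (J + 1), ?_⟩ fun S hS => ⟨1 + J * a + (J + 1), ?_⟩
  · refine IsSafe.forces hb hsum (1 + J * a) (U := ∅) ⟨by simp, by simp⟩ (by simp) ?_
    simp only [Finset.card_empty]
    omega
  · refine IsSafe.forces hb hsum (1 + J * a) (U := ∅) ⟨by simp, by simp⟩ (by simp) ?_
    have h1 : ((⟨∅, ∅⟩ : Position (Sym2 (Fin n))).claim S .maker).maker = S :=
      Finset.empty_union S
    have h2 : S.card ≤ a := hS.2.le.trans (min_le_left _ _)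
    rw [h1]
    omega

end

/-! ### Numerical estimates. -/

section

/-- The hyperbolic sum that governs the box game, bounded below by a logarithm. -/
theorem log_le_sum_div (a b J : ℕ) (ha : 1 ≤ a) :
    (b : ℝ) / a * (a + Real.log (J + 1) - 1) - J ≤
      ((∑ i ∈ Finset.range (J + 1), b / (1 + i * a) : ℕ) : ℝ) := by
  have ha' : (1 : ℝ) ≤ a := by exact_mod_cast ha
  -- Uses `1 + (i + 1) * a ≤ (i + 2) * a`; each floor loses at most 1, whence the `- J`.
  have hterm : ∀ i : ℕ, (b : ℝ) / a * ((i : ℝ) + 1 + 1)⁻¹ - 1 ≤ ((b / (1 + (i + 1) * a) : ℕ) : ℝ) := by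
    intro i
    have h1 : (b : ℝ) / ((1 + (i + 1) * a : ℕ) : ℝ) - 1 ≤ ((b / (1 + (i + 1) * a) : ℕ) : ℝ) := by
      rw [← Nat.floor_div_eq_div (K := ℝ)]
      exact (Nat.sub_one_lt_floor _).le
    refine le_trans (sub_le_sub_right ?_ 1) h1
    rw [div_mul_eq_mul_div, ← div_eq_mul_inv, div_div]
    push_cast
    gcongr
    nlinarith
  have hharm : Real.log (J + 1) ≤ 1 + ∑ i ∈ Finset.range J, ((i : ℝ) + 1 + 1)⁻¹ := by
    have h1 := log_add_one_le_harmonic J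
    have h2 : ((harmonic J : ℚ) : ℝ) = ∑ i ∈ Finset.range J, ((i : ℝ) + 1)⁻¹ := by
      simp [harmonic]
    rw [h2] at h1
    have h3 : ∑ i ∈ Finset.range J, ((i : ℝ) + 1)⁻¹ ≤
        ∑ i ∈ Finset.range (J + 1), ((i : ℝ) + 1)⁻¹ :=
      Finset.sum_le_sum_of_subset_of_nonneg (Finset.range_mono (Nat.le_succ J))
        fun i _ _ => by positivity
    rw [Finset.sum_range_succ'] at h3
    push_cast at h3
    norm_num at h3 h1 ⊢
    linarith
  rw [Finset.sum_range_succ']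
  push_cast
  have hsum := Finset.sum_le_sum fun i (_ : i ∈ Finset.range J) => hterm i
  rw [Finset.sum_sub_distrib, ← Finset.mul_sum] at hsum
  simp only [Finset.sum_const, Finset.card_range, nsmul_eq_mul, mul_one] at hsum
  simp only [zero_mul, add_zero, Nat.div_one]
  have hba : (b : ℝ) / a * a = b := div_mul_cancel₀ _ (by positivity)
  have hmul := mul_le_mul_of_nonneg_left hharm (show (0 : ℝ) ≤ (b : ℝ) / a by positivity)
  linarith

/-- The arithmetic of the case in which Maker's bias is at most logarithmic. -/
theorem exists_rounds {n a b : ℕ} {ε L : ℝ} (hε : 0 < ε) (ha : 1 ≤ a) (hL : Real.log n = L)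
    (hL1 : 1 ≤ L) (hn : L ^ 4 ≤ n) (haL : (a : ℝ) ≤ L / ε)
    (hLbig : 20 * (1 / ε + 1) ^ 2 ≤ L) (hLε : 2 ≤ ε / 4 * L)
    (hlog : (1 + ε) * (4 * Real.log L + 1) ≤ ε / 2 * L)
    (hb : (1 + ε) * ((a : ℝ) * n / (a + L)) ≤ b) :
    ∃ J : ℕ, 2 * ((2 + J * a) * a) + (1 + J * a) + (a + 1) ≤ n ∧
      (a + 1) * (1 + J * a + (a + 1)) ≤ b ∧
      n ≤ ∑ i ∈ Finset.range (J + 1), b / (1 + i * a) := by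
  have hL0 : 0 < L := by linarith
  have ha' : (1 : ℝ) ≤ a := by exact_mod_cast ha
  have hn0 : (0 : ℝ) < n := lt_of_lt_of_le (by positivity) hn
  set c : ℝ := 1 / ε + 1 with hc
  have hc1 : 1 ≤ c := by
    have : 0 < 1 / ε := by positivity
    linarith
  have haL' : (a : ℝ) + 1 ≤ c * L := by
    have : c * L = L / ε + L := by rw [hc]; ring
    linarith
  set m : ℝ := n / L ^ 4 with hm
  have hm1 : 1 ≤ m := (one_le_div (by positivity)).2 hn
  have hnm : (n : ℝ) = m * L ^ 4 := by rw [hm]; field_simp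
  -- Then `J * a ^ 2` is at most of order `n / L ^ 2`, below both `n` and `b ≥ n / (2 * L)`.
  set J := ⌊m⌋₊ with hJ
  have hJm : (J : ℝ) ≤ m := Nat.floor_le (by linarith)
  have hmJ : m < J + 1 := Nat.lt_floor_add_one m
  have hJa : (J : ℝ) * a ≤ m * (c * L) := by gcongr; linarith
  have hcL : 1 ≤ c * L := by nlinarith
  have hcLm : c * L ≤ m * (c * L) := le_mul_of_one_le_left (by linarith) hm1
  have hba : (1 + ε) * n / (a + L) ≤ (b : ℝ) / a := by
    rw [le_div_iff₀ (by linarith)]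
    calc _ = (1 + ε) * ((a : ℝ) * n / (a + L)) := by ring
      _ ≤ b := hb
  refine ⟨J, ?_, ?_, ?_⟩
  · have h1 : (2 + (J : ℝ) * a) * a ≤ 3 * m * (c * L) * (c * L) := by
      have : 2 + (J : ℝ) * a ≤ 3 * m * (c * L) := by linarith
      exact mul_le_mul this (by linarith) (by linarith) (by positivity)
    have h2 : m * (c * L) ≤ m * (c * L) * (c * L) :=
      le_mul_of_one_le_right (by positivity) hcL
    have h3 : 20 * (m * (c * L) * (c * L)) ≤ n := by
      calc 20 * (m * (c * L) * (c * L)) = m * (20 * c ^ 2 * L ^ 2) := by ring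
        _ ≤ m * (L * L ^ 2) := by gcongr
        _ = m * L ^ 3 := by ring
        _ ≤ m * L ^ 4 := by gcongr; norm_num
        _ = n := hnm.symm
    have h0 : 0 ≤ m * (c * L) * (c * L) := by positivity
    have h4 : (2 * ((2 + (J : ℝ) * a) * a) + (1 + J * a) + (a + 1)) ≤ n := by linarith
    exact_mod_cast h4
  · have h1 : ((a : ℝ) + 1) * (1 + J * a + (a + 1)) ≤ (c * L) * (3 * m * (c * L)) := by
      refine mul_le_mul haL' ?_ (by positivity) (by positivity)
      linarith
    have h2 : m * L ^ 3 / 2 ≤ b := by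
      have hab : (n : ℝ) / (2 * L) ≤ (a : ℝ) * n / (a + L) := by
        rw [div_le_div_iff₀ (by positivity) (by positivity)]
        have : (a : ℝ) + L ≤ a * (2 * L) := by nlinarith
        nlinarith
      have h0 : 0 ≤ (a : ℝ) * n / (a + L) := by positivity
      have hmn : m * L ^ 3 / 2 = n / (2 * L) := by rw [hnm]; field_simp
      have hε0 := mul_nonneg hε.le h0
      linarith
    have h3 : (c * L) * (3 * m * (c * L)) ≤ m * L ^ 3 / 2 := by
      have : 20 * c ^ 2 * (m * L ^ 2) ≤ L * (m * L ^ 2) := by gcongr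
      have h0 : 0 ≤ c ^ 2 * (m * L ^ 2) := by positivity
      nlinarith
    have h4 := h1.trans (h3.trans h2)
    exact_mod_cast h4
  · have h1 := log_le_sum_div a b J ha
    have h2 : L - 4 * Real.log L ≤ Real.log (J + 1) := by
      have : Real.log m = L - 4 * Real.log L := by
        rw [hm, Real.log_div hn0.ne' (by positivity), Real.log_pow, hL]
        norm_num
      rw [← this]
      exact Real.log_le_log (by linarith) hmJ.le
    -- `K` is the total loss in the logarithm. It and the floor loss `J` each use up half of the
    -- slack `ε`.
    set K := 4 * Real.log L + 1 with hK
    have hKL : 0 ≤ a + L - K := by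
      have : K ≤ L := by
        have hεL : 0 ≤ ε * L := by positivity
        refine le_of_mul_le_mul_left (hlog.trans ?_) (show 0 < 1 + ε by linarith)
        linarith
      linarith
    have h3 : (1 + ε) * n / (a + L) * (a + L - K) ≤ (b : ℝ) / a * (a + Real.log (J + 1) - 1) :=
      mul_le_mul hba (by linarith) hKL (by positivity)
    have h4 : (n : ℝ) + J ≤ (1 + ε) * n / (a + L) * (a + L - K) := by
      rw [div_mul_eq_mul_div, le_div_iff₀ (by positivity)]
      have hJn : (J : ℝ) ≤ ε / 2 * n := by
        rw [hnm]
        have : 1 ≤ ε / 2 * L ^ 4 := by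
          have hLL : ε / 4 * L ≤ ε / 4 * L ^ 4 := by
            gcongr
            exact le_self_pow₀ hL1 (by norm_num)
          linarith
        calc (J : ℝ) ≤ m * 1 := by rwa [mul_one]
          _ ≤ m * (ε / 2 * L ^ 4) := by gcongr
          _ = ε / 2 * (m * L ^ 4) := by ring
      have hsum : 0 ≤ (a : ℝ) + L := by positivity
      have hA : ((n : ℝ) + J) * (a + L) ≤ (1 + ε / 2) * n * (a + L) := by
        gcongr
        linarith
      have hB : (1 + ε) * K * n ≤ ε / 2 * (a + L) * n := by
        refine mul_le_mul_of_nonneg_right ?_ hn0.le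
        have hεa : 0 ≤ ε / 2 * a := by positivity
        linarith
      linarith
    have h5 : (n : ℝ) ≤ ((∑ i ∈ Finset.range (J + 1), b / (1 + i * a) : ℕ) : ℝ) := by linarith
    exact_mod_cast h5

end

end MakerBreaker

theorem mainTheorem4 (a k : ℕ → ℕ) (ha_pos : ∀ n, 1 ≤ a n) (hk_pos : ∀ n, 1 ≤ k n)
    (ha : (fun n : ℕ => (a n : ℝ)) =o[Filter.atTop] (fun n : ℕ => Real.sqrt (n : ℝ)))
    (hk : (fun n : ℕ => (k n : ℝ)) =o[Filter.atTop] (fun n : ℕ => (n : ℝ)))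
    (ε : ℝ) (hε : 0 < ε) :
    ∃ n₀ : ℕ, ∀ n : ℕ, n₀ ≤ n → ∀ b : ℕ,
      (1 + ε) * ((a n : ℝ) * (n : ℝ) / ((a n : ℝ) + Real.log (n : ℝ))) ≤ (b : ℝ) →
        ∀ first : MakerBreaker.Player,
          MakerBreaker.BreakerWinsMinDegree n (k n) (a n) b first := by
  have hlogn : Filter.Tendsto (fun n : ℕ => Real.log (n : ℝ)) Filter.atTop Filter.atTop :=
    Real.tendsto_log_atTop.comp tendsto_natCast_atTop_atTop
  have hpow : ∀ᶠ n : ℕ in Filter.atTop, Real.log (n : ℝ) ^ 4 ≤ n := by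
    have h := ((Real.isLittleO_pow_log_id_atTop (n := 4)).comp_tendsto
      (tendsto_natCast_atTop_atTop (R := ℝ))).bound one_pos
    filter_upwards [h] with n hn
    simp only [Function.comp_apply, id, one_mul, Real.norm_eq_abs, Nat.abs_cast] at hn
    exact (le_abs_self _).trans hn
  have hloglog : ∀ᶠ L : ℝ in Filter.atTop, (1 + ε) * (4 * Real.log L + 1) ≤ ε / 2 * L := by
    have hδ : 0 < ε / (16 * (1 + ε)) := by positivity
    filter_upwards [Real.isLittleO_log_id_atTop.bound hδ,
      Filter.eventually_ge_atTop (4 * (1 + ε) / ε), Filter.eventually_ge_atTop 0]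
      with L h1 h2 h3
    simp only [id, Real.norm_eq_abs, abs_of_nonneg h3] at h1
    have h4 := (le_abs_self _).trans h1
    rw [div_mul_eq_mul_div, le_div_iff₀ (by positivity)] at h4
    rw [div_le_iff₀ hε] at h2
    linarith
  have hall := hlogn.eventually (hloglog.and ((Filter.eventually_ge_atTop 1).and
    ((Filter.eventually_ge_atTop (20 * (1 / ε + 1) ^ 2)).and
      (Filter.eventually_ge_atTop (8 / ε)))))
  obtain ⟨n₀, hn₀⟩ := Filter.eventually_atTop.1 (hall.and (hpow.and (ha.bound
    (show (0 : ℝ) < 1 / 4 by norm_num))))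
  refine ⟨n₀, fun n hn b hb first => ?_⟩
  obtain ⟨⟨h1, h2, h3, h4⟩, h5, h6⟩ := hn₀ n hn
  have han : 16 * (a n) ^ 2 ≤ n := by
    rw [Real.norm_eq_abs, Real.norm_eq_abs, Nat.abs_cast, abs_of_nonneg (Real.sqrt_nonneg _)]
      at h6
    have hs := Real.sq_sqrt (Nat.cast_nonneg (α := ℝ) n)
    have h7 : (16 : ℝ) * (a n : ℝ) ^ 2 ≤ n := by
      nlinarith [Nat.cast_nonneg (α := ℝ) (a n), Real.sqrt_nonneg (n : ℝ)]
    exact_mod_cast h7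
  have ha1 := ha_pos n
  -- If `b ≥ n`, one safe vertex suffices (`J = 0`), with room from `16 * a ^ 2 ≤ n`. Otherwise the
  -- bound on `b` forces `ε * a ≤ ln n`.
  rcases le_or_gt n b with hnb | hnb
  · refine MakerBreaker.breakerWinsMinDegree_of_le_sum (hk_pos n) 0 ?_ ?_ (by simpa using hnb) first
    · nlinarith
    · nlinarith
  · have ha' : (1 : ℝ) ≤ a n := by exact_mod_cast ha1
    have hn0 : (0 : ℝ) < n := by
      have : 0 < n := by omega
      exact_mod_cast this
    have haL : (a n : ℝ) ≤ Real.log n / ε := by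
      have h7 : (1 + ε) * ((a n : ℝ) * (n : ℝ) / ((a n : ℝ) + Real.log (n : ℝ))) < n :=
        hb.trans_lt (by exact_mod_cast hnb)
      rw [← mul_div_assoc, div_lt_iff₀ (by linarith)] at h7
      rw [le_div_iff₀ hε]
      nlinarith
    obtain ⟨J, hJ1, hJ2, hJ3⟩ := MakerBreaker.exists_rounds hε ha1 rfl h2 h5 haL h3
      (by rw [div_le_iff₀ hε] at h4; linarith) h1 hb
    exact MakerBreaker.breakerWinsMinDegree_of_le_sum (hk_pos n) J hJ1 hJ2 hJ3 first
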